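/- \textbf{Theorem.} Let $\mathbb F$ be a finite field. Algebras over $\mathbb F$ are not assumed associative, commutative or unital; an \emph{ideal} of an algebra is a vector subspace closed under left and right multiplication by arbitrary elements of the algebra. For an algebra $P$, let $P^i$ be the linear span of the values in $P$ of all nonassociative monomials of degree $i$, and let $I(P)=\{x\in P : ax=xa=0 \text{ for all } a\in P\}$ be its annihilator. A \emph{primitive class} (variety) $\mathfrak V$ is the class of all algebras over $\mathbb F$ satisfying the identities $w=0$, $w\in W$, for a given set $W$ of nonassociative polynomials over $\mathbb F$ in countably many variables; its relatively free algebra $F_n=F_n(\mathfrak V)$ of rank $n$ is the absolutely free algebra on $x_1,\dots,x_n$ modulo the ideal generated by all values in it of the polynomials $w\in W$. The class $\mathfrak V$ is \emph{$c$-step nilpotent} if $P^{c+1}=\{0\}$ for every $P\in\mathfrak V$ and $P^c\neq\{0\}$ for some $P\in\mathfrak V$. Let $c\ge 2$ and let $\mathfrak V$ be a $c$-step nilpotent primitive class over $\mathbb F$ which is \emph{central}, that is, $I(F_n)=F_n^c$ for all $n\ge 2$. For each $n$ let $S_n$ be the set of all ideals of $F_n$ and $T_n\subseteq S_n$ the set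 of those ideals that are contained in $F_n^c$. Then every $S_n$ is finite, and being contained in $F_n^c$ is an exponentially generic property of the ideals of the sequence $F_1,F_2,\dots$: one has $|T_n|/|S_n|\to 1$ as $n\to\infty$, and there is a real number $r$ with $0\le r<1$ (which may depend on $\mathfrak V$) such that $|T_n|/|S_n|>1-r^n$ for all sufficiently large $n$. -/

import Mathlib

open Filter Topology

/-! Algebras over a field `𝕜` are not assumed associative, commutative or unital: an algebra is a type
`P` with `NonUnitalNonAssocRing P`, `Module 𝕜 P`, `IsScalarTower 𝕜 P P`, `SMulCommClass 𝕜 P P`. -/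

namespace NilAlg

universe u v

section Algebra

variable (𝕜 : Type u) [Field 𝕜]
variable (P : Type v) [NonUnitalNonAssocRing P] [Module 𝕜 P]

/-- A two-sided ideal of an algebra: a vector subspace absorbing multiplication on both sides. -/
@[ext]
structure AlgIdeal extends Submodule 𝕜 P where
  mul_mem_left' : ∀ (a x : P), x ∈ carrier → a * x ∈ carrier
  mul_mem_right' : ∀ (a x : P), x ∈ carrier → x * a ∈ carrier

/-- The power `P ^ i`: the linear span of the values in `P` of all nonassociative monomials of
degree `i`. -/
def power (i : ℕ) : Submodule 𝕜 P :=
  Submodule.span 𝕜 {p | ∃ (m : FreeMagma ℕ) (a : ℕ → P), m.length = i ∧ p = FreeMagma.lift a m}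

variable [IsScalarTower 𝕜 P P] [SMulCommClass 𝕜 P P]

/-- The annihilator `I(P) = {x | a x = x a = 0 for all a}`. -/
def annihilator : Submodule 𝕜 P where
  carrier := {x | ∀ a : P, a * x = 0 ∧ x * a = 0}
  zero_mem' := by intro a; simp
  add_mem' := by
    intro x y hx hy a
    simp [mul_add, add_mul, (hx a).1, (hx a).2, (hy a).1, (hy a).2]
  smul_mem' := by
    intro r x hx a
    simp [mul_smul_comm, smul_mul_assoc, (hx a).1, (hx a).2]

/-- The least ideal of `P` containing the set `S`. -/
def idealSpan (S : Set P) : AlgIdeal 𝕜 P where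
  carrier := {x | ∀ N : AlgIdeal 𝕜 P, S ⊆ N.carrier → x ∈ N.carrier}
  zero_mem' := fun N _ => N.zero_mem'
  add_mem' := fun hx hy N hN => N.add_mem' (hx N hN) (hy N hN)
  smul_mem' := fun r _ hx N hN => N.smul_mem' r (hx N hN)
  mul_mem_left' := fun a x hx N hN => N.mul_mem_left' a x (hx N hN)
  mul_mem_right' := fun a x hx N hN => N.mul_mem_right' a x (hx N hN)

/-- `P` satisfies the identities `w = 0`, `w ∈ W`, i.e. `P` belongs to the primitive class (variety)
defined by the set `W` of nonassociative polynomials in the variables `x₀, x₁, …`. -/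
def Satisfies (W : Set (FreeNonUnitalNonAssocAlgebra 𝕜 ℕ)) : Prop :=
  ∀ w ∈ W, ∀ a : ℕ → P, FreeNonUnitalNonAssocAlgebra.lift 𝕜 a w = 0

/-- The verbal ideal of `P` for the primitive class defined by `W`: the ideal generated by all
values in `P` of the polynomials in `W`. -/
def verbalIdeal (W : Set (FreeNonUnitalNonAssocAlgebra 𝕜 ℕ)) : AlgIdeal 𝕜 P :=
  idealSpan 𝕜 P {p | ∃ w ∈ W, ∃ a : ℕ → P, p = FreeNonUnitalNonAssocAlgebra.lift 𝕜 a w}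

end Algebra

section Quotient

variable {𝕜 : Type u} [Field 𝕜] {P : Type v} [NonUnitalNonAssocRing P] [Module 𝕜 P]

/-- The quotient algebra `P / N`. -/
def AlgIdeal.Quot (N : AlgIdeal 𝕜 P) : Type v := P ⧸ N.toSubmodule

namespace AlgIdeal

variable (N : AlgIdeal 𝕜 P)

instance : AddCommGroup N.Quot := inferInstanceAs (AddCommGroup (P ⧸ N.toSubmodule))

instance : Module 𝕜 N.Quot := inferInstanceAs (Module 𝕜 (P ⧸ N.toSubmodule))

/-- The natural linear map `P → P / N`. -/
def proj : P →ₗ[𝕜] N.Quot := N.toSubmodule.mkQ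

theorem proj_surjective : Function.Surjective N.proj := N.toSubmodule.mkQ_surjective

theorem proj_eq_proj {x y : P} : N.proj x = N.proj y ↔ x - y ∈ N.toSubmodule :=
  Submodule.Quotient.eq N.toSubmodule

instance : Mul N.Quot :=
  ⟨fun x y => Quotient.liftOn₂' x y (fun a b => N.proj (a * b)) (by
    intro a b a' b' h h'
    have h1 : a - a' ∈ N.toSubmodule := (Submodule.quotientRel_def _).1 h
    have h2 : b - b' ∈ N.toSubmodule := (Submodule.quotientRel_def _).1 h'
    refine (N.proj_eq_proj).2 ?_
    have e : a * b - a' * b' = (a - a') * b + a' * (b - b') := by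
      rw [sub_mul, mul_sub]; abel
    rw [e]
    exact N.toSubmodule.add_mem (N.mul_mem_right' _ _ h1) (N.mul_mem_left' _ _ h2))⟩

theorem proj_mul (a b : P) : N.proj (a * b) = N.proj a * N.proj b := rfl

instance : NonUnitalNonAssocRing N.Quot :=
  { (inferInstance : AddCommGroup N.Quot), (inferInstance : Mul N.Quot) with
    left_distrib := by
      intro x y z
      obtain ⟨a, rfl⟩ := N.proj_surjective x
      obtain ⟨b, rfl⟩ := N.proj_surjective y
      obtain ⟨c, rfl⟩ := N.proj_surjective z
      rw [← map_add, ← proj_mul, mul_add, map_add, proj_mul, proj_mul]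
    right_distrib := by
      intro x y z
      obtain ⟨a, rfl⟩ := N.proj_surjective x
      obtain ⟨b, rfl⟩ := N.proj_surjective y
      obtain ⟨c, rfl⟩ := N.proj_surjective z
      rw [← map_add, ← proj_mul, add_mul, map_add, proj_mul, proj_mul]
    zero_mul := by
      intro x
      obtain ⟨a, rfl⟩ := N.proj_surjective x
      rw [← map_zero N.proj, ← proj_mul, zero_mul]
    mul_zero := by
      intro x
      obtain ⟨a, rfl⟩ := N.proj_surjective x
      rw [← map_zero N.proj, ← proj_mul, mul_zero] }

instance [IsScalarTower 𝕜 P P] : IsScalarTower 𝕜 N.Quot N.Quot :=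
  ⟨by
    intro r x y
    obtain ⟨a, rfl⟩ := N.proj_surjective x
    obtain ⟨b, rfl⟩ := N.proj_surjective y
    change (r • N.proj a) * N.proj b = r • (N.proj a * N.proj b)
    rw [← map_smul, ← proj_mul, ← proj_mul, smul_mul_assoc, map_smul]⟩

instance [SMulCommClass 𝕜 P P] : SMulCommClass 𝕜 N.Quot N.Quot :=
  ⟨by
    intro r x y
    obtain ⟨a, rfl⟩ := N.proj_surjective x
    obtain ⟨b, rfl⟩ := N.proj_surjective y
    change r • (N.proj a * N.proj b) = N.proj a * (r • N.proj b)
    rw [← map_smul, ← proj_mul, ← proj_mul, mul_smul_comm, map_smul]⟩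

end AlgIdeal

end Quotient

section PrimitiveClass

variable {𝕜 : Type u} [Field 𝕜] (W : Set (FreeNonUnitalNonAssocAlgebra 𝕜 ℕ))

/-- The relatively free algebra `F_n` of rank `n` of the primitive class defined by `W`: the
absolutely free algebra on `x₁, …, x_n` modulo its verbal ideal. -/
abbrev RelFree (n : ℕ) : Type u :=
  (verbalIdeal 𝕜 (FreeNonUnitalNonAssocAlgebra 𝕜 (Fin n)) W).Quot

/-- The primitive class defined by `W` is `c`-step nilpotent: `P ^ (c + 1) = 0` for each of its
algebras `P`, and `P ^ c ≠ 0` for at least one of them. -/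
def IsStepNilpotentClass (c : ℕ) : Prop :=
  (∀ (P : Type u) [NonUnitalNonAssocRing P] [Module 𝕜 P] [IsScalarTower 𝕜 P P]
      [SMulCommClass 𝕜 P P], Satisfies 𝕜 P W → power 𝕜 P (c + 1) = ⊥) ∧
  ∃ (P : Type u) (_ : NonUnitalNonAssocRing P) (_ : Module 𝕜 P) (_ : IsScalarTower 𝕜 P P)
      (_ : SMulCommClass 𝕜 P P), Satisfies 𝕜 P W ∧ power 𝕜 P c ≠ ⊥

/-- The primitive class defined by `W` is a central `c`-step nilpotent class: `c ≥ 2`, it is `c`-step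
nilpotent, and `I(F_n) = F_n ^ c` for all `n ≥ 2`. Nothing is required of rank one, where
the free algebra of, say, the `c`-step nilpotent Lie algebras is its own annihilator and has
`F_1 ^ c = 0`. -/
def IsCentralClass (c : ℕ) : Prop :=
  2 ≤ c ∧ IsStepNilpotentClass W c ∧
    ∀ n : ℕ, 2 ≤ n → annihilator 𝕜 (RelFree W n) = power 𝕜 (RelFree W n) c

end PrimitiveClass

section Generic

/-- The proportion of the elements of `S n` that lie in `T n`. -/
noncomputable def proportion {S : ℕ → Type u} (T : ∀ n, Set (S n)) (n : ℕ) : ℝ :=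
  ((T n).ncard : ℝ) / (Nat.card (S n) : ℝ)

/-- Membership in `T n` is an exponentially generic property for the elements of the sequence of
finite sets `S n`: the proportion `|T n| / |S n|` tends to `1`, and it does so faster than `1 - r ^ n`
for some `0 ≤ r < 1`. -/
def IsExponentiallyGeneric {S : ℕ → Type u} (T : ∀ n, Set (S n)) : Prop :=
  (∀ n, Finite (S n)) ∧
  Tendsto (proportion T) atTop (𝓝 1) ∧
  ∃ r : ℝ, 0 ≤ r ∧ r < 1 ∧ ∀ᶠ n in atTop, 1 - r ^ n < proportion T n

end Generic

end NilAlg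

/-!
Write `q = |𝕜|`, `F = F_n`, `Z = F ^ c`, `d = dim Z`, `e = dim F / Z`. Centrality says that `Z` is the
annihilator of `F`, so every subspace of `Z` is an ideal, and there are at least as many ideals inside
`Z` as subspaces of a `d`-dimensional space. The ideals not contained in `Z` are few because they are
forced to contain large subspaces.

*Growth.* Let `P` be a subspace of `F / Z`. Multiplication by a generator `x_j` on either side is well
defined as a map `F / Z → F`; let `L(P)` (`genProducts`) be the span of all products of `P` with the
generators. Then `(n - c) dim P ≤ 2 c dim L(P)` (`mul_finrank_le_genProducts`). The identities of `W`
need not be homogeneous, so `F` need not be graded by degree, but it is graded by the set of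
generators that occur in a monomial: the endomorphisms sending some of the generators to `0` and
fixing the others split `F` by Möbius inversion (`supportProj`). Order the supports by
`∑_{i ∈ S} 2 ^ i`, and take leading components. If `y` is the leading component of an element of `P`,
of support `T`, and `j ∉ T`, then `y x_j` and `x_j y` are zero or the leading components of elements
of `L(P)`, of support `T ∪ {j}`. They are not both zero unless `y = 0`: the endomorphism fixing the
`x_i`, `i ∈ T`, and sending `x_j` to an arbitrary `a` would give `y a = a y = 0` for all `a`, whence
`y ∈ I(F) = Z` (`mem_annihilator_of_mul_gen_eq_zero`). Summing over all `T` and `j ∉ T` gives the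
inequality, as supports of nonzero components have at most `c` elements.

*Counting.* An ideal `N` not contained in `Z` has a nonzero image `P` in `F / Z`, of dimension `k`, say,
and `L(P) ⊆ N ⊆ N + Z`. For large `n` the dimension of `L(P)` is at least `3 k`, so `N` corresponds to
a subspace of a space of dimension at most `d + k - 3 k = d - 2 k`. The number of subspaces of a
`(D + 2 k)`-dimensional space is at least `q ^ (k D)` times that of a `D`-dimensional one
(`card_submodule_of_finrank_add_le`), and there are at most `q ^ (k e)` choices of `P`; since the growth
inequality for `P = F / Z` also shows that `d` is much larger than `e`, at most a fraction
`q ^ (4 e - d)` of the ideals is not contained in `Z` (`ncard_not_le_mul_pow_le`), and `d - 4 e` grows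
at least linearly in `n` unless `e = 0`, when all ideals lie in `Z`.
-/

namespace NilAlg

universe u v

/-! ### Numbers of subspaces over a finite field -/

section Counting

variable {𝕜 U V : Type*} [Field 𝕜] [AddCommGroup U] [Module 𝕜 U] [AddCommGroup V] [Module 𝕜 V]

theorem exists_linearMap_injective_of_finrank_le [FiniteDimensional 𝕜 U] [FiniteDimensional 𝕜 V]
    (h : Module.finrank 𝕜 U ≤ Module.finrank 𝕜 V) :
    ∃ f : U →ₗ[𝕜] V, Function.Injective f := by
  let bU := Module.finBasis 𝕜 U
  let bV := Module.finBasis 𝕜 V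
  exact ⟨bU.constr ℕ (bV ∘ Fin.castLE h), bU.injective_constr_of_linearIndependent
    (bV.linearIndependent.comp _ (Fin.castLE_injective h))⟩

theorem card_submodule_le_of_injective [Finite V] (f : U →ₗ[𝕜] V) (hf : Function.Injective f) :
    Nat.card (Submodule 𝕜 U) ≤ Nat.card (Submodule 𝕜 V) :=
  Nat.card_le_card_of_injective _ (Submodule.map_injective_of_injective hf)

/-- A triple of a subspace `N` of `U`, a linear map `f : N → 𝕜 ^ k` and a linear map `u` from `𝕜 ^ k` to
a fixed complement of `N` yields the subspace `{(y + u a, a, f y)}` of `U × 𝕜 ^ k × 𝕜 ^ k`, and is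
recovered from it. For each `N` there are `q ^ (k dim U)` such pairs `(f, u)`. -/
theorem card_submodule_prod [Finite 𝕜] [Finite U] (k : ℕ) :
    Nat.card 𝕜 ^ (k * Module.finrank 𝕜 U) * Nat.card (Submodule 𝕜 U) ≤
      Nat.card (Submodule 𝕜 (U × (Fin k → 𝕜) × (Fin k → 𝕜))) := by
  choose C hC using fun N : Submodule 𝕜 U => Submodule.exists_isCompl N
  let g (N : Submodule 𝕜 U) (f : N →ₗ[𝕜] (Fin k → 𝕜)) (u : (Fin k → 𝕜) →ₗ[𝕜] C N) :
      N × (Fin k → 𝕜) →ₗ[𝕜] U × (Fin k → 𝕜) × (Fin k → 𝕜) :=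
    (LinearMap.coprod N.subtype ((C N).subtype ∘ₗ u)).prod
      ((LinearMap.snd 𝕜 _ _).prod (f ∘ₗ LinearMap.fst 𝕜 _ _))
  let Φ : (Σ N : Submodule 𝕜 U, (N →ₗ[𝕜] (Fin k → 𝕜)) × ((Fin k → 𝕜) →ₗ[𝕜] C N)) →
      Submodule 𝕜 (U × (Fin k → 𝕜) × (Fin k → 𝕜)) := fun s => LinearMap.range (g s.1 s.2.1 s.2.2)
  have hmem : ∀ N f u x a b, (x, a, b) ∈ Φ ⟨N, f, u⟩ ↔ ∃ y : N, (y : U) + u a = x ∧ f y = b := by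
    intro N f u x a b
    simp [Φ, g, Prod.ext_iff]
  have hΦ : Function.Injective Φ := by
    -- `N` consists of the first coordinates of the elements with second coordinate zero.
    have hle : ∀ s t, Φ s = Φ t → s.1 ≤ t.1 := by
      rintro ⟨N, f, u⟩ ⟨N', f', u'⟩ h x hx
      have h1 : (x, 0, f ⟨x, hx⟩) ∈ Φ ⟨N, f, u⟩ := (hmem _ _ _ _ _ _).2 ⟨⟨x, hx⟩, by simp, rfl⟩
      rw [h, hmem] at h1
      obtain ⟨y, hy, -⟩ := h1
      simp only [map_zero, ZeroMemClass.coe_zero, add_zero] at hy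
      exact hy ▸ y.2
    rintro ⟨N, f, u⟩ ⟨N', f', u'⟩ h
    obtain rfl : N = N' := le_antisymm (hle _ _ h) (hle _ _ h.symm)
    have hf : f = f' := by
      ext1 y
      have h1 : ((y : U), 0, f y) ∈ Φ ⟨N, f, u⟩ := (hmem _ _ _ _ _ _).2 ⟨y, by simp, rfl⟩
      rw [h, hmem] at h1
      obtain ⟨y', hy, hb⟩ := h1
      obtain rfl : y' = y := by ext; simpa using hy
      exact hb.symm
    have hu : u = u' := by
      refine LinearMap.ext fun a => ?_
      have h1 : ((u a : U), a, 0) ∈ Φ ⟨N, f, u⟩ := (hmem _ _ _ _ _ _).2 ⟨0, by simp, by simp⟩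
      rw [h, hmem] at h1
      obtain ⟨y', hy, -⟩ := h1
      have h2 : (y' : U) = ((u a - u' a : C N) : U) := by
        rw [Submodule.coe_sub, eq_sub_iff_add_eq, hy]
      have h3 : ((u a - u' a : C N) : U) = 0 :=
        Submodule.disjoint_def.1 (hC N).disjoint _ (h2 ▸ y'.2) (u a - u' a).2
      exact sub_eq_zero.1 (Subtype.ext h3)
    rw [hf, hu]
  have hcard : ∀ N : Submodule 𝕜 U,
      Nat.card ((N →ₗ[𝕜] (Fin k → 𝕜)) × ((Fin k → 𝕜) →ₗ[𝕜] C N)) =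
        Nat.card 𝕜 ^ (k * Module.finrank 𝕜 U) := by
    intro N
    rw [Nat.card_prod, Module.natCard_eq_pow_finrank (K := 𝕜),
      Module.natCard_eq_pow_finrank (K := 𝕜) (V := (Fin k → 𝕜) →ₗ[𝕜] C N), ← pow_add,
      Module.finrank_linearMap, Module.finrank_linearMap, Module.finrank_fin_fun,
      ← Submodule.finrank_add_eq_of_isCompl (hC N)]
    congr 1
    ring
  have : Finite (U × (Fin k → 𝕜) × (Fin k → 𝕜)) := inferInstance
  have hfin : ∀ N : Submodule 𝕜 U,
      Finite ((N →ₗ[𝕜] (Fin k → 𝕜)) × ((Fin k → 𝕜) →ₗ[𝕜] C N)) := fun N =>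
    have := Module.finite_of_finite 𝕜 (M := N →ₗ[𝕜] (Fin k → 𝕜))
    have := Module.finite_of_finite 𝕜 (M := (Fin k → 𝕜) →ₗ[𝕜] C N)
    inferInstance
  calc _ = Nat.card (Σ N : Submodule 𝕜 U, (N →ₗ[𝕜] (Fin k → 𝕜)) × ((Fin k → 𝕜) →ₗ[𝕜] C N)) := by
        have := Fintype.ofFinite (Submodule 𝕜 U)
        rw [Nat.card_sigma, Finset.sum_congr rfl (fun N _ => hcard N)]
        simp [mul_comm]
    _ ≤ _ := Nat.card_le_card_of_injective _ hΦ

theorem card_submodule_of_finrank_add_le [Finite 𝕜] [Finite U] [Finite V] (k : ℕ)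
    (h : Module.finrank 𝕜 U + 2 * k ≤ Module.finrank 𝕜 V) :
    Nat.card 𝕜 ^ (k * Module.finrank 𝕜 U) * Nat.card (Submodule 𝕜 U) ≤
      Nat.card (Submodule 𝕜 V) := by
  obtain ⟨f, hf⟩ := exists_linearMap_injective_of_finrank_le (𝕜 := 𝕜)
    (U := U × (Fin k → 𝕜) × (Fin k → 𝕜)) (V := V) (by simp; omega)
  exact (card_submodule_prod k).trans (card_submodule_le_of_injective f hf)

/-- There are at most as many subspaces between `L` and `P` as subspaces of `U`, if
`dim P - dim L ≤ dim U`. -/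
theorem card_submodule_interval_le [Finite 𝕜] [Finite U] [Finite V] (L P : Submodule 𝕜 V)
    (h : Module.finrank 𝕜 P ≤ Module.finrank 𝕜 U + Module.finrank 𝕜 L) :
    {N : Submodule 𝕜 V | L ≤ N ∧ N ≤ P}.ncard ≤ Nat.card (Submodule 𝕜 U) := by
  by_cases hLP : L ≤ P
  swap
  · rw [show {N : Submodule 𝕜 V | L ≤ N ∧ N ≤ P} = ∅ by
      ext N; simpa using fun h1 h2 => hLP (h1.trans h2)]
    simp
  let L' : Submodule 𝕜 P := L.comap P.subtype
  have hL' : Module.finrank 𝕜 L' = Module.finrank 𝕜 L :=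
    (Submodule.comapSubtypeEquivOfLe hLP).finrank_eq
  have h1 := L'.finrank_quotient_add_finrank
  obtain ⟨f, hf⟩ := exists_linearMap_injective_of_finrank_le (𝕜 := 𝕜) (U := P ⧸ L') (V := U)
    (by omega)
  refine le_trans ?_ (card_submodule_le_of_injective f hf)
  rw [← Nat.card_coe_set_eq]
  have : Finite (P ⧸ L') := Finite.of_surjective _ L'.mkQ_surjective
  refine Nat.card_le_card_of_injective (fun N => (N.1.comap P.subtype).map L'.mkQ) ?_
  rintro ⟨N, hN⟩ ⟨N', hN'⟩ h
  have h2 : ∀ M : Submodule 𝕜 V, L ≤ M → M ≤ P →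
      ((((M.comap P.subtype).map L'.mkQ)).comap L'.mkQ).map P.subtype = M := by
    intro M hM hM'
    rw [Submodule.comap_map_mkQ, sup_eq_right.2 (Submodule.comap_mono hM),
      Submodule.map_comap_subtype, inf_eq_right.2 hM']
  refine Subtype.ext ((h2 N hN.1 hN.2).symm.trans (Eq.trans ?_ (h2 N' hN'.1 hN'.2)))
  exact congrArg (fun Q => (Q.comap L'.mkQ).map P.subtype) h

/-- The bound is the number of `k`-tuples of vectors, one of which spans a given subspace of
dimension `k`. -/
theorem ncard_submodule_finrank_eq_le [Finite 𝕜] [Finite V] (k : ℕ) :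
    {P : Submodule 𝕜 V | Module.finrank 𝕜 P = k}.ncard ≤
      Nat.card 𝕜 ^ (k * Module.finrank 𝕜 V) := by
  have h1 : Nat.card (Fin k → V) = Nat.card 𝕜 ^ (k * Module.finrank 𝕜 V) := by
    rw [Nat.card_fun, Module.natCard_eq_pow_finrank (K := 𝕜) (V := V), ← pow_mul, Nat.card_fin,
      mul_comm]
  rw [← h1, ← Set.ncard_univ]
  refine (Set.ncard_le_ncard ?_ (Set.toFinite _)).trans
    (Set.ncard_image_le (f := fun v : Fin k → V => Submodule.span 𝕜 (Set.range v))
      (Set.toFinite _))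
  rintro P rfl
  let b := Module.finBasis 𝕜 P
  refine ⟨fun i => (b i : V), trivial, ?_⟩
  have := congrArg (Submodule.map P.subtype) b.span_eq
  rwa [Submodule.map_span, ← Set.range_comp, Submodule.map_subtype_top] at this

/-- Let each subspace `P` of `V / Z` be assigned a subspace `L P` of `V` of at least three times its
dimension. Then a subspace `N ⊈ Z` that contains `L` of its own image in `V / Z` is rare: there are at
most `q ^ (4 dim V / Z - dim Z)` times as many of these as there are subspaces of `Z`. -/
theorem ncard_not_le_mul_pow_le [Finite 𝕜] [Finite V] (Z : Submodule 𝕜 V)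
    (L : Submodule 𝕜 (V ⧸ Z) → Submodule 𝕜 V)
    (hL : ∀ P : Submodule 𝕜 (V ⧸ Z), 3 * Module.finrank 𝕜 P ≤ Module.finrank 𝕜 (L P))
    (hZ : 4 * Module.finrank 𝕜 (V ⧸ Z) ≤ Module.finrank 𝕜 Z) :
    {N : Submodule 𝕜 V | ¬ N ≤ Z ∧ L (N.map Z.mkQ) ≤ N}.ncard *
        Nat.card 𝕜 ^ (Module.finrank 𝕜 Z - 4 * Module.finrank 𝕜 (V ⧸ Z)) ≤
      Nat.card (Submodule 𝕜 Z) := by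
  classical
  have : Finite (V ⧸ Z) := Finite.of_surjective _ Z.mkQ_surjective
  have := Fintype.ofFinite (Submodule 𝕜 (V ⧸ Z))
  set d := Module.finrank 𝕜 Z with hd
  set e := Module.finrank 𝕜 (V ⧸ Z) with he
  set q := Nat.card 𝕜 with hq
  have hq1 : 1 < q := Finite.one_lt_card
  let s (k : ℕ) : ℕ := Nat.card (Submodule 𝕜 (Fin (d - 2 * k) → 𝕜))
  have hle : ∀ P : Submodule 𝕜 (V ⧸ Z), Module.finrank 𝕜 P ≤ e := fun P => P.finrank_le
  have hfib : ∀ P : Submodule 𝕜 (V ⧸ Z),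
      {N : Submodule 𝕜 V | L P ≤ N ∧ N ≤ P.comap Z.mkQ}.ncard ≤ s (Module.finrank 𝕜 P) := by
    intro P
    refine card_submodule_interval_le _ _ ?_
    have h1 : Module.finrank 𝕜 (P.comap Z.mkQ) = Module.finrank 𝕜 P + d := by
      have h2 := (Z.mkQ.domRestrict (P.comap Z.mkQ)).finrank_range_add_finrank_ker
      rw [LinearMap.range_domRestrict, Submodule.map_comap_eq_of_surjective Z.mkQ_surjective,
        LinearMap.ker_domRestrict, Submodule.ker_mkQ] at h2
      rw [← h2, hd]
      congr 1
      refine (LinearEquiv.finrank_eq (Submodule.comapSubtypeEquivOfLe ?_))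
      intro z hz
      simp [(Submodule.Quotient.mk_eq_zero Z).2 hz]
    have h2 := hL P
    have h3 := hle P
    rw [h1, Module.finrank_fin_fun]
    omega
  have hsub : {N : Submodule 𝕜 V | ¬ N ≤ Z ∧ L (N.map Z.mkQ) ≤ N} ⊆
      ⋃ P ∈ Finset.univ.filter (fun P : Submodule 𝕜 (V ⧸ Z) => P ≠ ⊥),
        {N : Submodule 𝕜 V | L P ≤ N ∧ N ≤ P.comap Z.mkQ} := by
    rintro N ⟨h1, h2⟩
    simp only [Finset.mem_filter, Finset.mem_univ, true_and, Set.mem_iUnion]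
    refine ⟨N.map Z.mkQ, fun h => h1 ?_, h2, Submodule.le_comap_map _ _⟩
    rw [← Z.ker_mkQ]
    exact LinearMap.le_ker_iff_map.2 h
  -- The contribution of the `P` of dimension `k`; the factor `e` pays for the sum over `k`.
  have hs : ∀ k ∈ Finset.Icc 1 e,
      e * (q ^ (k * e) * s k * q ^ (d - 4 * e)) ≤ Nat.card (Submodule 𝕜 Z) := by
    intro k hk
    obtain ⟨hk1, hk2⟩ := Finset.mem_Icc.1 hk
    have h1 : q ^ (k * (d - 2 * k)) * s k ≤ Nat.card (Submodule 𝕜 Z) := by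
      have := card_submodule_of_finrank_add_le (𝕜 := 𝕜) (U := Fin (d - 2 * k) → 𝕜) (V := Z) k
        (by rw [Module.finrank_fin_fun]; omega)
      rwa [Module.finrank_fin_fun] at this
    refine le_trans ?_ h1
    have h2 : e ≤ q ^ e := (Nat.lt_pow_self hq1).le
    calc e * (q ^ (k * e) * s k * q ^ (d - 4 * e))
        ≤ q ^ e * (q ^ (k * e) * s k * q ^ (d - 4 * e)) := Nat.mul_le_mul_right _ h2
      _ = q ^ (e + k * e + (d - 4 * e)) * s k := by ring
      _ ≤ q ^ (k * (d - 2 * k)) * s k := by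
        refine Nat.mul_le_mul_right _ (Nat.pow_le_pow_right hq1.le ?_)
        have h3 : k * e + (d - 3 * e) ≤ k * (d - 2 * k) := by
          calc k * e + (d - 3 * e) ≤ k * e + k * (d - 3 * e) :=
                Nat.add_le_add_left (Nat.le_mul_of_pos_left _ hk1) _
            _ = k * (e + (d - 3 * e)) := by ring
            _ ≤ k * (d - 2 * k) := Nat.mul_le_mul_left _ (by omega)
        omega
  rcases Nat.eq_zero_or_pos e with he0 | he0
  · have : Subsingleton (V ⧸ Z) := Module.finrank_zero_iff.1 he0
    have hemp : {N : Submodule 𝕜 V | ¬ N ≤ Z ∧ L (N.map Z.mkQ) ≤ N} = ∅ := by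
      ext N
      simp only [Set.mem_ofPred_eq, Set.mem_empty_iff_false, iff_false, not_and]
      exact fun h => absurd (fun x _ => (Submodule.Quotient.mk_eq_zero Z).1
        (Subsingleton.elim _ _)) h
    rw [hemp]; simp
  refine Nat.le_of_mul_le_mul_left ?_ he0
  have hcount : {N : Submodule 𝕜 V | ¬ N ≤ Z ∧ L (N.map Z.mkQ) ≤ N}.ncard ≤
      ∑ k ∈ Finset.Icc 1 e, q ^ (k * e) * s k := by
    calc _ ≤ ∑ P ∈ Finset.univ.filter (fun P : Submodule 𝕜 (V ⧸ Z) => P ≠ ⊥),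
          {N : Submodule 𝕜 V | L P ≤ N ∧ N ≤ P.comap Z.mkQ}.ncard :=
        (Set.ncard_le_ncard hsub (Set.toFinite _)).trans (Finset.set_ncard_biUnion_le _ _)
      _ ≤ ∑ P ∈ Finset.univ.filter (fun P : Submodule 𝕜 (V ⧸ Z) => P ≠ ⊥),
          s (Module.finrank 𝕜 P) := Finset.sum_le_sum fun P _ => hfib P
      _ = ∑ k ∈ Finset.Icc 1 e, ∑ P ∈ (Finset.univ.filter
          (fun P : Submodule 𝕜 (V ⧸ Z) => P ≠ ⊥)).filter (fun P : Submodule 𝕜 (V ⧸ Z) => Module.finrank 𝕜 P = k),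
          s (Module.finrank 𝕜 P) := by
        refine (Finset.sum_fiberwise_of_maps_to (fun P hP => ?_) _).symm
        have hP' : P ≠ ⊥ := (Finset.mem_filter.1 hP).2
        exact Finset.mem_Icc.2 ⟨Nat.pos_of_ne_zero fun h => hP' (Submodule.finrank_eq_zero.1 h),
          hle P⟩
      _ ≤ _ := by
        refine Finset.sum_le_sum fun k _ => ?_
        rw [Finset.sum_congr rfl (g := fun _ => s k) (fun P hP => by rw [(Finset.mem_filter.1 hP).2]),
          Finset.sum_const, smul_eq_mul]
        refine Nat.mul_le_mul_right _ (le_trans ?_ (ncard_submodule_finrank_eq_le (V := V ⧸ Z) k))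
        rw [← Set.ncard_coe_finset]
        refine Set.ncard_le_ncard (fun P hP => ?_) (Set.toFinite _)
        exact (Finset.mem_filter.1 hP).2
  calc _ ≤ e * ((∑ k ∈ Finset.Icc 1 e, q ^ (k * e) * s k) * q ^ (d - 4 * e)) :=
        Nat.mul_le_mul_left _ (Nat.mul_le_mul_right _ hcount)
    _ = ∑ k ∈ Finset.Icc 1 e, e * (q ^ (k * e) * s k * q ^ (d - 4 * e)) := by
        rw [Finset.sum_mul, Finset.mul_sum]
    _ ≤ ∑ k ∈ Finset.Icc 1 e, Nat.card (Submodule 𝕜 Z) := Finset.sum_le_sum hs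
    _ = _ := by simp

end Counting

/-! ### Leading components and growth of dimension -/

section Growth

variable {𝕜 : Type*} [Field 𝕜] {A B : Type*} [AddCommGroup A] [Module 𝕜 A]
  [AddCommGroup B] [Module 𝕜 B]

/-- The leading components at `i` of the elements of `Q`: the values `p i x` for those `x ∈ Q` for which
`p j x = 0` for all `j` of larger weight than `i`. -/
def leading {ι : Type*} (w : ι → ℕ) (p : ι → A →ₗ[𝕜] A) (Q : Submodule 𝕜 A) (i : ι) :
    Submodule 𝕜 A :=
  (Q ⊓ ⨅ j, ⨅ (_ : w i < w j), LinearMap.ker (p j)).map (p i)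

theorem mem_leading {ι : Type*} {w : ι → ℕ} {p : ι → A →ₗ[𝕜] A} {Q : Submodule 𝕜 A} {i : ι}
    {y : A} : y ∈ leading w p Q i ↔ ∃ x ∈ Q, (∀ j, w i < w j → p j x = 0) ∧ p i x = y := by
  simp [leading, and_assoc]

/-- The dimension of a subspace is the sum of the dimensions of its spaces of leading components. -/
theorem sum_finrank_leading [FiniteDimensional 𝕜 A] {ι : Type*} [Fintype ι] (w : ι → ℕ)
    (hw : Function.Injective w) (p : ι → A →ₗ[𝕜] A) (hp : ∀ x, ∑ i, p i x = x)
    (Q : Submodule 𝕜 A) :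
    ∑ i, Module.finrank 𝕜 (leading w p Q i) = Module.finrank 𝕜 Q := by
  classical
  -- Indices are added in decreasing order of weight; each step is rank-nullity for `p a`.
  have key : ∀ s : Finset ι,
      Module.finrank 𝕜 (Q ⊓ ⨅ j ∈ s, LinearMap.ker (p j) : Submodule 𝕜 A) +
        ∑ i ∈ s, Module.finrank 𝕜 ((Q ⊓ ⨅ j ∈ s.filter (fun j => w i < w j),
          LinearMap.ker (p j) : Submodule 𝕜 A).map (p i)) = Module.finrank 𝕜 Q := by
    intro s
    induction s using Finset.induction_on_min_value w with
    | empty =>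
      have h1 : (⨅ j ∈ (∅ : Finset ι), LinearMap.ker (p j)) = ⊤ := by
        ext x
        simp
      rw [h1, inf_top_eq, Finset.sum_empty, add_zero]
    | insert a s ha hmin ih =>
      have hlt : ∀ x ∈ s, w a < w x := fun x hx =>
        lt_of_le_of_ne (hmin x hx) fun h => ha (hw h ▸ hx)
      rw [Finset.sum_insert ha, ← ih, ← add_assoc]
      congr 1
      · have h1 : (insert a s).filter (fun j => w a < w j) = s := by
          ext x
          simp only [Finset.mem_filter, Finset.mem_insert]
          constructor
          · rintro ⟨rfl | h, h'⟩
            · exact absurd h' (lt_irrefl _)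
            · exact h
          · exact fun h => ⟨Or.inr h, hlt x h⟩
        rw [h1]
        set K : Submodule 𝕜 A := Q ⊓ ⨅ j ∈ s, LinearMap.ker (p j) with hK
        have h2 : (Q ⊓ ⨅ j ∈ insert a s, LinearMap.ker (p j) : Submodule 𝕜 A) =
            K ⊓ LinearMap.ker (p a) := by
          rw [hK, Finset.iInf_insert, inf_comm (LinearMap.ker (p a)), inf_assoc]
        rw [h2]
        have h3 := ((p a).domRestrict K).finrank_range_add_finrank_ker
        rw [LinearMap.range_domRestrict, LinearMap.ker_domRestrict] at h3
        rw [← h3, add_comm]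
        congr 1
        rw [← Submodule.map_comap_subtype]
        exact Submodule.finrank_map_subtype_eq _ _
      · refine Finset.sum_congr rfl fun i hi => ?_
        have h1 : (insert a s).filter (fun j => w i < w j) = s.filter (fun j => w i < w j) := by
          rw [Finset.filter_insert, if_neg (hlt i hi).le.not_gt]
        rw [h1]
  have h := key Finset.univ
  have h0 : (Q ⊓ ⨅ j ∈ Finset.univ, LinearMap.ker (p j) : Submodule 𝕜 A) = ⊥ := by
    rw [eq_bot_iff]
    rintro x ⟨-, hx⟩
    have hx' : ∀ j, p j x = 0 := by simpa using hx
    rw [Submodule.mem_bot, ← hp x]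
    simp [hx']
  rw [h0, finrank_bot, zero_add] at h
  rw [← h]
  refine Finset.sum_congr rfl fun i _ => ?_
  have h1 : (⨅ j ∈ Finset.univ.filter (fun j => w i < w j), LinearMap.ker (p j)) =
      ⨅ j, ⨅ (_ : w i < w j), LinearMap.ker (p j) := by
    ext x
    simp [Submodule.mem_iInf]
  rw [leading, h1]

/-- The weight `∑_{i ∈ S} 2 ^ i` of a set of generators. It separates sets, and adding a generator to two
sets preserves their order as long as the larger one did not contain it. -/
def weight {n : ℕ} (S : Finset (Fin n)) : ℕ := ∑ i ∈ S, 2 ^ (i : ℕ)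

theorem weight_injective {n : ℕ} : Function.Injective (weight (n := n)) := by
  intro S T h
  refine Finset.map_injective Fin.valEmbedding (Finset.geomSum_injective le_rfl ?_)
  simpa [weight] using h

theorem weight_insert {n : ℕ} {S : Finset (Fin n)} {j : Fin n} (hj : j ∉ S) :
    weight (insert j S) = 2 ^ (j : ℕ) + weight S := Finset.sum_insert hj

theorem weight_insert_le {n : ℕ} (S : Finset (Fin n)) (j : Fin n) :
    weight (insert j S) ≤ 2 ^ (j : ℕ) + weight S := by
  by_cases hj : j ∈ S
  · rw [Finset.insert_eq_of_mem hj]; exact Nat.le_add_left _ _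
  · exact (weight_insert hj).le

/-- `p` is a family of idempotents with sum `1`, indexed by the sets of generators, that vanishes on the
sets with more than `c` elements. Orthogonality is not required. -/
structure IsSupportDecomposition {n : ℕ} (c : ℕ) (p : Finset (Fin n) → A →ₗ[𝕜] A) : Prop where
  sum_apply : ∀ x, ∑ S, p S x = x
  apply_self : ∀ S x, p S (p S x) = p S x
  eq_zero : ∀ S, c < S.card → p S = 0

variable {n c : ℕ} {p : Finset (Fin n) → A →ₗ[𝕜] A} {p' : Finset (Fin n) → B →ₗ[𝕜] B}

/-- The map `f` sends the component of support `S` to the one of support `S ∪ {j}`. -/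
def RaisesSupport (p : Finset (Fin n) → A →ₗ[𝕜] A) (p' : Finset (Fin n) → B →ₗ[𝕜] B)
    (j : Fin n) (f : A →ₗ[𝕜] B) : Prop :=
  ∀ S U x, p' U (f (p S x)) = if U = insert j S then f (p S x) else 0

theorem IsSupportDecomposition.finrank_leading_eq_zero (hp : IsSupportDecomposition c p)
    {w : Finset (Fin n) → ℕ} (Q : Submodule 𝕜 A) {T : Finset (Fin n)} (hT : c < T.card) :
    Module.finrank 𝕜 (leading w p Q T) = 0 := by
  rw [leading, hp.eq_zero T hT, Submodule.map_zero, finrank_bot]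

theorem RaisesSupport.apply_mem_leading (hp : IsSupportDecomposition c p) {j : Fin n}
    {f : A →ₗ[𝕜] B} (hf : RaisesSupport p p' j f) {P : Submodule 𝕜 A} {L : Submodule 𝕜 B}
    (hL : P.map f ≤ L) {T : Finset (Fin n)} (hj : j ∉ T) {y : A} (hy : y ∈ leading weight p P T) :
    f y ∈ leading weight p' L (insert j T) := by
  classical
  obtain ⟨x, hxP, hx, rfl⟩ := mem_leading.1 hy
  have hpf : ∀ U, p' U (f x) = ∑ S, if U = insert j S then f (p S x) else 0 := by
    intro U
    conv_lhs => rw [← hp.sum_apply x, map_sum, map_sum]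
    exact Finset.sum_congr rfl fun S _ => hf S U x
  have hT := weight_insert hj
  refine mem_leading.2 ⟨f x, hL ⟨x, hxP, rfl⟩, fun U hU => ?_, ?_⟩
  · rw [hpf]
    refine Finset.sum_eq_zero fun S _ => ?_
    split_ifs with h
    · have := weight_insert_le S j
      rw [hx S (by rw [h] at hU; omega), map_zero]
    · rfl
  -- The other support `S` with `S ∪ {j} = T ∪ {j}` is `T ∪ {j}` itself, of larger weight than `T`.
  · rw [hpf, Finset.sum_eq_single T, if_pos rfl]
    · intro S _ hST
      split_ifs with h
      · have hjS : j ∈ S := by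
          by_contra hjS
          apply hST
          rw [← Finset.erase_insert hjS, ← h, Finset.erase_insert hj]
        rw [Finset.insert_eq_of_mem hjS] at h
        have : 0 < 2 ^ (j : ℕ) := by positivity
        rw [hx S (by rw [← h]; omega), map_zero]
      · rfl
    · simp

theorem finrank_leading_le [FiniteDimensional 𝕜 B] (hp : IsSupportDecomposition c p)
    {j : Fin n} {f g : A →ₗ[𝕜] B} (hf : RaisesSupport p p' j f) (hg : RaisesSupport p p' j g)
    {T : Finset (Fin n)} (hj : j ∉ T)
    (hinj : ∀ x, p T x = x → f x = 0 → g x = 0 → x = 0)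
    {P : Submodule 𝕜 A} {L : Submodule 𝕜 B} (hfL : P.map f ≤ L) (hgL : P.map g ≤ L) :
    Module.finrank 𝕜 (leading weight p P T) ≤
      2 * Module.finrank 𝕜 (leading weight p' L (insert j T)) := by
  let M := leading weight p' L (insert j T)
  let φ : leading weight p P T →ₗ[𝕜] M × M :=
    (f.restrict fun y hy => hf.apply_mem_leading hp hfL hj hy).prod
      (g.restrict fun y hy => hg.apply_mem_leading hp hgL hj hy)
  have hφ : Function.Injective φ := by
    rw [← LinearMap.ker_eq_bot, LinearMap.ker_eq_bot']
    rintro ⟨y, hy⟩ h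
    have h1 : f y = 0 := congrArg Subtype.val (congrArg Prod.fst h)
    have h2 : g y = 0 := congrArg Subtype.val (congrArg Prod.snd h)
    obtain ⟨x, -, -, rfl⟩ := mem_leading.1 hy
    exact Subtype.ext (hinj _ (hp.apply_self _ _) h1 h2)
  have := LinearMap.finrank_le_finrank_of_injective hφ
  rwa [Module.finrank_prod, ← two_mul] at this

/-- If `f j` and `g j` add `j` to supports and have no common zero among the elements of a support
without `j`, then the span of the images of `P` under these maps is larger than `P` by a factor of at
least `(n - c) / (2 c)`. -/
theorem mul_finrank_le [FiniteDimensional 𝕜 A] [FiniteDimensional 𝕜 B]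
    (hp : IsSupportDecomposition c p) (hp' : IsSupportDecomposition c p')
    {f g : Fin n → A →ₗ[𝕜] B} (hf : ∀ j, RaisesSupport p p' j (f j))
    (hg : ∀ j, RaisesSupport p p' j (g j))
    (hinj : ∀ T, ∀ j ∉ T, ∀ x, p T x = x → f j x = 0 → g j x = 0 → x = 0)
    {P : Submodule 𝕜 A} {L : Submodule 𝕜 B} (hfL : ∀ j, P.map (f j) ≤ L)
    (hgL : ∀ j, P.map (g j) ≤ L) :
    (n - c) * Module.finrank 𝕜 P ≤ 2 * c * Module.finrank 𝕜 L := by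
  classical
  rw [← sum_finrank_leading weight weight_injective p hp.sum_apply P,
    ← sum_finrank_leading weight weight_injective p' hp'.sum_apply L, Finset.mul_sum,
    Finset.mul_sum]
  set a := fun T => Module.finrank 𝕜 (leading weight p P T) with ha
  set b := fun T => Module.finrank 𝕜 (leading weight p' L T) with hb
  calc ∑ T, (n - c) * a T ≤ ∑ T : Finset (Fin n), ∑ j ∈ Tᶜ, a T := by
        refine Finset.sum_le_sum fun T _ => ?_
        rw [Finset.sum_const, Finset.card_compl, Fintype.card_fin, smul_eq_mul]
        by_cases hT : c < T.card
        · simp only [ha, hp.finrank_leading_eq_zero P hT, mul_zero, le_refl]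
        · exact Nat.mul_le_mul_right _ (by omega)
    _ ≤ ∑ T : Finset (Fin n), ∑ j ∈ Tᶜ, 2 * b (insert j T) := by
        refine Finset.sum_le_sum fun T _ => Finset.sum_le_sum fun j hj => ?_
        have hj' := Finset.mem_compl.1 hj
        exact finrank_leading_le hp (hf j) (hg j) hj' (hinj T j hj') (hfL j) (hgL j)
    -- Pairs `(T, j)` with `j ∉ T` correspond to pairs `(U, j)` with `j ∈ U = T ∪ {j}`.
    _ = ∑ U : Finset (Fin n), ∑ j ∈ U, 2 * b U := by
        rw [Finset.sum_sigma', Finset.sum_sigma']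
        refine Finset.sum_bij' (fun x _ => ⟨insert x.2 x.1, x.2⟩) (fun x _ => ⟨x.1.erase x.2, x.2⟩)
          ?_ ?_ ?_ ?_ ?_
        · rintro ⟨T, j⟩ h; simp
        · rintro ⟨T, j⟩ h; simp
        · rintro ⟨T, j⟩ h
          have : j ∉ T := by simpa using h
          simp [Finset.erase_insert this]
        · rintro ⟨T, j⟩ h
          have : j ∈ T := by simpa using h
          simp [Finset.insert_erase this]
        · rintro ⟨T, j⟩ h; rfl
    _ ≤ ∑ U, 2 * c * b U := by
        refine Finset.sum_le_sum fun U _ => ?_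
        rw [Finset.sum_const, smul_eq_mul]
        by_cases hU : c < U.card
        · simp only [hb, hp'.finrank_leading_eq_zero L hU, mul_zero, le_refl]
        · calc U.card * (2 * b U) ≤ c * (2 * b U) := Nat.mul_le_mul_right _ (by omega)
            _ = 2 * c * b U := by ring

end Growth

/-! ### Monomials -/

section Monomial

variable {𝕜 : Type u} [Field 𝕜]

theorem map_mem_power {P Q : Type*} [NonUnitalNonAssocRing P] [Module 𝕜 P]
    [NonUnitalNonAssocRing Q] [Module 𝕜 Q] (φ : P →ₙₐ[𝕜] Q) {i : ℕ} {x : P}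
    (hx : x ∈ power 𝕜 P i) : φ x ∈ power 𝕜 Q i := by
  induction hx using Submodule.span_induction with
  | mem x hx =>
    obtain ⟨m, a, hm, rfl⟩ := hx
    refine Submodule.subset_span ⟨m, φ ∘ a, hm, ?_⟩
    have h : (φ : P →ₙ* Q).comp (FreeMagma.lift a) = FreeMagma.lift (φ ∘ a) :=
      FreeMagma.hom_ext rfl
    exact DFunLike.congr_fun h m
  | zero => rw [map_zero]; exact Submodule.zero_mem _
  | add x y _ _ hx hy => rw [map_add]; exact Submodule.add_mem _ hx hy
  | smul r x _ hx => rw [map_smul]; exact Submodule.smul_mem _ r hx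

/-- A monomial of length at least `i ≥ 1` takes the values of a monomial of length `i`: cut off
subtrees of its tree and substitute their values for new variables. -/
theorem exists_lift_eq_of_le_length {X P : Type*} [Mul P] (b : X → P) (m : FreeMagma X) (i : ℕ)
    (hi : 1 ≤ i) (him : i ≤ m.length) :
    ∃ (m' : FreeMagma ℕ) (a : ℕ → P), m'.length = i ∧ FreeMagma.lift b m = FreeMagma.lift a m' := by
  induction m generalizing i with
  | ih1 x =>
    refine ⟨FreeMagma.of 0, fun _ => b x, ?_, rfl⟩
    change i ≤ 1 at him
    exact le_antisymm hi him
  | ih2 x y ihx ihy =>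
    rcases Nat.eq_or_lt_of_le hi with rfl | hi
    · exact ⟨FreeMagma.of 0, fun _ => FreeMagma.lift b (x * y), rfl, rfl⟩
    change i ≤ x.length + y.length at him
    have hx := x.length_pos
    have hy := y.length_pos
    obtain ⟨i₁, i₂, h₁, h₂, h₃, h₄, rfl⟩ : ∃ i₁ i₂, 1 ≤ i₁ ∧ i₁ ≤ x.length ∧ 1 ≤ i₂ ∧
        i₂ ≤ y.length ∧ i = i₁ + i₂ :=
      ⟨min x.length (i - 1), i - min x.length (i - 1), by omega, by omega, by omega, by omega,
        by omega⟩
    obtain ⟨m₁, a₁, hm₁, e₁⟩ := ihx i₁ h₁ h₂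
    obtain ⟨m₂, a₂, hm₂, e₂⟩ := ihy i₂ h₃ h₄
    have hlen : ∀ (s : ℕ → ℕ) (m : FreeMagma ℕ), (FreeMagma.map s m).length = m.length := by
      intro s m
      induction m with
      | ih1 x => rfl
      | ih2 x y hx hy =>
        rw [map_mul]
        exact congrArg₂ (· + ·) hx hy
    have hlift : ∀ (s : ℕ → ℕ) (a : ℕ → P) (m : FreeMagma ℕ),
        FreeMagma.lift a (FreeMagma.map s m) = FreeMagma.lift (a ∘ s) m := by
      intro s a m
      have h : (FreeMagma.lift a).comp (FreeMagma.map s) = FreeMagma.lift (a ∘ s) :=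
        FreeMagma.hom_ext rfl
      exact DFunLike.congr_fun h m
    -- The variables of the two factors are kept apart by parity.
    refine ⟨FreeMagma.map (fun t => 2 * t) m₁ * FreeMagma.map (fun t => 2 * t + 1) m₂,
      fun t => if t % 2 = 0 then a₁ (t / 2) else a₂ (t / 2), ?_, ?_⟩
    · exact congrArg₂ (· + ·) ((hlen _ _).trans hm₁) ((hlen _ _).trans hm₂)
    · rw [map_mul, map_mul, hlift, hlift, e₁, e₂]
      congr 3
      · ext t; simp
      · ext t
        have h1 : (2 * t + 1) % 2 = 1 := by omega
        have h2 : (2 * t + 1) / 2 = t := by omega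
        simp [h1, h2]

theorem finite_setOf_length_le (X : Type*) [Finite X] (l : ℕ) :
    {m : FreeMagma X | m.length ≤ l}.Finite := by
  induction l with
  | zero =>
    convert Set.finite_empty
    ext m
    simpa using m.length_pos.ne'
  | succ l ih =>
    refine ((Set.finite_range (FreeMagma.of : X → FreeMagma X)).union
      (Set.Finite.image2 (· * ·) ih ih)).subset ?_
    intro m hm
    induction m with
    | ih1 x => exact Or.inl ⟨x, rfl⟩
    | ih2 x y _ _ =>
      have hm' : x.length + y.length ≤ l + 1 := hm
      have hx := x.length_pos
      have hy := y.length_pos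
      exact Or.inr ⟨x, by simp only [Set.mem_ofPred_eq]; omega, y,
        by simp only [Set.mem_ofPred_eq]; omega, rfl⟩

/-- The set of variables that occur in a monomial. -/
def supp {X : Type*} [DecidableEq X] : FreeMagma X → Finset X
  | FreeMagma.of x => {x}
  | x * y => supp x ∪ supp y

theorem supp_of {X : Type*} [DecidableEq X] (x : X) : supp (FreeMagma.of x) = {x} := rfl

theorem supp_mul {X : Type*} [DecidableEq X] (x y : FreeMagma X) :
    supp (x * y) = supp x ∪ supp y := rfl

theorem card_supp_le {X : Type*} [DecidableEq X] (m : FreeMagma X) : (supp m).card ≤ m.length := by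
  induction m with
  | ih1 x => exact (Finset.card_singleton x).le
  | ih2 x y hx hy => exact (Finset.card_union_le _ _).trans (Nat.add_le_add hx hy)

end Monomial

/-! ### Relatively free algebras and their endomorphisms -/

section RelFree

variable {𝕜 : Type u} [Field 𝕜] {P : Type v} [NonUnitalNonAssocRing P] [Module 𝕜 P]

/-- The natural homomorphism `P → P / N`. -/
def AlgIdeal.projHom (N : AlgIdeal 𝕜 P) : P →ₙₐ[𝕜] N.Quot where
  toFun := N.proj
  map_smul' := map_smul N.proj
  map_zero' := map_zero N.proj
  map_add' := map_add N.proj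
  map_mul' := N.proj_mul

variable [IsScalarTower 𝕜 P P] [SMulCommClass 𝕜 P P]
variable (W : Set (FreeNonUnitalNonAssocAlgebra 𝕜 ℕ))

theorem map_lift {X Q : Type*} [NonUnitalNonAssocRing Q] [Module 𝕜 Q] [IsScalarTower 𝕜 Q Q]
    [SMulCommClass 𝕜 Q Q] (φ : P →ₙₐ[𝕜] Q) (a : X → P) (w : FreeNonUnitalNonAssocAlgebra 𝕜 X) :
    φ (FreeNonUnitalNonAssocAlgebra.lift 𝕜 a w) =
      FreeNonUnitalNonAssocAlgebra.lift 𝕜 (φ ∘ a) w := by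
  have h : φ.comp (FreeNonUnitalNonAssocAlgebra.lift 𝕜 a) =
      FreeNonUnitalNonAssocAlgebra.lift 𝕜 (φ ∘ a) := by
    refine FreeNonUnitalNonAssocAlgebra.hom_ext 𝕜 fun x => ?_
    rw [NonUnitalAlgHom.comp_apply, FreeNonUnitalNonAssocAlgebra.lift_of_apply,
      FreeNonUnitalNonAssocAlgebra.lift_of_apply, Function.comp_apply]
  exact DFunLike.congr_fun h w

theorem satisfies_relFree (n : ℕ) : Satisfies 𝕜 (RelFree W n) W := by
  intro w hw a
  set I := verbalIdeal 𝕜 (FreeNonUnitalNonAssocAlgebra 𝕜 (Fin n)) W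
  choose b hb using fun i => I.proj_surjective (a i)
  obtain rfl : I.projHom ∘ b = a := funext hb
  rw [← map_lift]
  refine (Submodule.Quotient.mk_eq_zero _).2 ?_
  exact fun N hN => hN ⟨w, hw, b, rfl⟩

/-- The free generator `x_i` of `F_n`. -/
noncomputable def gen (n : ℕ) (i : Fin n) : RelFree W n :=
  AlgIdeal.proj _ (FreeNonUnitalNonAssocAlgebra.of 𝕜 i)

/-- The value of a monomial at the free generators of `F_n`. -/
noncomputable def mono (n : ℕ) : FreeMagma (Fin n) →ₙ* RelFree W n := FreeMagma.lift (gen W n)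

theorem mono_of (n : ℕ) (i : Fin n) : mono W n (FreeMagma.of i) = gen W n i := rfl

variable {W}

/-- The universal property of `F_n`. -/
theorem exists_hom {n : ℕ} (hP : Satisfies 𝕜 P W) (a : Fin n → P) :
    ∃ φ : RelFree W n →ₙₐ[𝕜] P, ∀ i, φ (gen W n i) = a i := by
  set I := verbalIdeal 𝕜 (FreeNonUnitalNonAssocAlgebra 𝕜 (Fin n)) W with hI
  let ψ := FreeNonUnitalNonAssocAlgebra.lift 𝕜 a
  let ψl : FreeNonUnitalNonAssocAlgebra 𝕜 (Fin n) →ₗ[𝕜] P := (ψ : _ →ₗ[𝕜] P)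
  let K : AlgIdeal 𝕜 (FreeNonUnitalNonAssocAlgebra 𝕜 (Fin n)) :=
    { LinearMap.ker ψl with
      mul_mem_left' := fun y x (hx : ψ x = 0) => show ψ (y * x) = 0 by rw [map_mul, hx, mul_zero]
      mul_mem_right' := fun y x (hx : ψ x = 0) => show ψ (x * y) = 0 by rw [map_mul, hx, zero_mul] }
  have hle : I.toSubmodule ≤ LinearMap.ker ψl := by
    intro x hx
    refine hx K ?_
    rintro _ ⟨w, hw, b, rfl⟩
    change ψ _ = 0
    rw [map_lift]
    exact hP w hw _
  let φ : I.Quot →ₗ[𝕜] P := I.toSubmodule.liftQ ψl hle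
  have hφ : ∀ x, φ (I.proj x) = ψ x := fun x => rfl
  refine ⟨{ toFun := φ, map_smul' := map_smul φ, map_zero' := map_zero φ, map_add' := map_add φ,
            map_mul' := ?_ }, fun i => ?_⟩
  · intro x y
    obtain ⟨x, rfl⟩ := I.proj_surjective x
    obtain ⟨y, rfl⟩ := I.proj_surjective y
    change φ (I.proj x * I.proj y) = φ (I.proj x) * φ (I.proj y)
    rw [← I.proj_mul, hφ, hφ, hφ, map_mul]
  · change φ (I.proj _) = _
    rw [hφ]
    exact FreeNonUnitalNonAssocAlgebra.lift_of_apply 𝕜 a i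

theorem span_range_mono (n : ℕ) : Submodule.span 𝕜 (Set.range (mono W n)) = ⊤ := by
  rw [eq_top_iff]
  rintro x -
  set I := verbalIdeal 𝕜 (FreeNonUnitalNonAssocAlgebra 𝕜 (Fin n)) W with hI
  obtain ⟨x, rfl⟩ := I.proj_surjective x
  have hm : ∀ m : FreeMagma (Fin n),
      I.proj (MonoidAlgebra.ofMagma 𝕜 (FreeMagma (Fin n)) m) = mono W n m := by
    intro m
    have h : ((I.projHom : _ →ₙ* I.Quot)).comp (MonoidAlgebra.ofMagma 𝕜 (FreeMagma (Fin n))) =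
        mono W n := FreeMagma.hom_ext rfl
    exact DFunLike.congr_fun h m
  induction x using MonoidAlgebra.induction_linear with
  | zero => rw [map_zero]; exact Submodule.zero_mem _
  | add x y hx hy => rw [map_add]; exact Submodule.add_mem _ hx hy
  | single m r =>
    have : (MonoidAlgebra.single m r : FreeNonUnitalNonAssocAlgebra 𝕜 (Fin n)) =
        r • MonoidAlgebra.ofMagma 𝕜 (FreeMagma (Fin n)) m := by
      simp [MonoidAlgebra.ofMagma]
    rw [this, map_smul, hm]
    exact Submodule.smul_mem _ _ (Submodule.subset_span ⟨m, rfl⟩)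

theorem linearMap_ext_mono {n : ℕ} {M : Type*} [AddCommGroup M] [Module 𝕜 M]
    {f g : RelFree W n →ₗ[𝕜] M} (h : ∀ m, f (mono W n m) = g (mono W n m)) : f = g :=
  LinearMap.ext_on_range (span_range_mono n) h

theorem map_mono {Q : Type*} [NonUnitalNonAssocRing Q] [Module 𝕜 Q] {n : ℕ}
    (φ : RelFree W n →ₙₐ[𝕜] Q) {a : Fin n → Q}
    (h : ∀ i, φ (gen W n i) = a i) (m : FreeMagma (Fin n)) :
    φ (mono W n m) = FreeMagma.lift a m := by
  have h' : (φ : RelFree W n →ₙ* Q).comp (mono W n) = FreeMagma.lift a :=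
    FreeMagma.hom_ext (funext h)
  exact DFunLike.congr_fun h' m

theorem lift_congr_supp {X Q : Type*} [DecidableEq X] [Mul Q] {a b : X → Q} {m : FreeMagma X}
    (h : ∀ i ∈ supp m, a i = b i) : FreeMagma.lift a m = FreeMagma.lift b m := by
  induction m with
  | ih1 x => exact h x (Finset.mem_singleton_self x)
  | ih2 x y hx hy =>
    rw [map_mul, map_mul, hx fun i hi => h i (Finset.mem_union_left _ hi),
      hy fun i hi => h i (Finset.mem_union_right _ hi)]

theorem lift_eq_zero_of_mem_supp {X Q : Type*} [DecidableEq X] [NonUnitalNonAssocRing Q]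
    {a : X → Q} {m : FreeMagma X} {i : X} (hi : i ∈ supp m) (h : a i = 0) :
    FreeMagma.lift a m = 0 := by
  induction m with
  | ih1 x => rw [supp_of, Finset.mem_singleton] at hi; exact hi ▸ h
  | ih2 x y hx hy =>
    rw [supp_mul, Finset.mem_union] at hi
    rw [map_mul]
    rcases hi with hi | hi
    · rw [hx hi, zero_mul]
    · rw [hy hi, mul_zero]

variable (W) in
/-- The endomorphism fixing the generators in `U` and sending the others to `0`. -/
theorem exists_restrict_hom (n : ℕ) (U : Finset (Fin n)) :
    ∃ φ : RelFree W n →ₙₐ[𝕜] RelFree W n,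
      ∀ m, φ (mono W n m) = if supp m ⊆ U then mono W n m else 0 := by
  obtain ⟨φ, hφ⟩ := exists_hom (satisfies_relFree W n) (fun i => if i ∈ U then gen W n i else 0)
  refine ⟨φ, fun m => ?_⟩
  rw [map_mono φ hφ]
  split_ifs with h
  · exact lift_congr_supp fun i hi => if_pos (h hi)
  · obtain ⟨i, hi, hiU⟩ := Finset.not_subset.1 h
    exact lift_eq_zero_of_mem_supp hi (if_neg hiU)

variable (W) in
/-- The projection of `F_n` to the span of the monomials of support `U` is well defined. It is a linear
combination of endomorphisms of `F_n`, by the recursion `p_U = φ_U - ∑_{S ⊂ U} p_S`, where `φ_U` kills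
the generators outside `U`; hence it preserves all powers of `F_n`. -/
theorem exists_supportProj (n : ℕ) (U : Finset (Fin n)) :
    ∃ p : RelFree W n →ₗ[𝕜] RelFree W n,
      (∀ m, p (mono W n m) = if supp m = U then mono W n m else 0) ∧
      ∀ i, power 𝕜 (RelFree W n) i ≤ (power 𝕜 (RelFree W n) i).comap p := by
  induction U using Finset.strongInduction with
  | H U ih =>
  choose! p hp hpow using ih
  obtain ⟨φ, hφ⟩ := exists_restrict_hom W n U
  refine ⟨(φ : RelFree W n →ₗ[𝕜] RelFree W n) - ∑ S ∈ U.ssubsets, p S, fun m => ?_,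
    fun i x hx => ?_⟩
  · rw [LinearMap.sub_apply, LinearMap.sum_apply,
      Finset.sum_congr rfl (fun S hS => hp S (Finset.mem_ssubsets.1 hS) m), Finset.sum_ite_eq]
    change φ _ - _ = _
    rw [hφ]
    simp only [Finset.mem_ssubsets]
    by_cases h1 : supp m = U
    · simp [h1]
    · by_cases h2 : supp m ⊆ U
      · simp [h1, h2, Finset.ssubset_iff_subset_ne]
      · simp [h1, h2, Finset.ssubset_iff_subset_ne]
  · rw [Submodule.mem_comap, LinearMap.sub_apply, LinearMap.sum_apply]
    exact Submodule.sub_mem _ (map_mem_power φ hx) (Submodule.sum_mem _ fun S hS =>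
      hpow S (Finset.mem_ssubsets.1 hS) i hx)

variable (W) in
/-- The projection of `F_n` to the span of the monomials in which exactly the generators in `U` occur,
along the span of the other monomials. -/
noncomputable def supportProj (n : ℕ) (U : Finset (Fin n)) : RelFree W n →ₗ[𝕜] RelFree W n :=
  (exists_supportProj W n U).choose

theorem supportProj_mono {n : ℕ} (U : Finset (Fin n)) (m : FreeMagma (Fin n)) :
    supportProj W n U (mono W n m) = if supp m = U then mono W n m else 0 :=
  (exists_supportProj W n U).choose_spec.1 m

theorem power_le_comap_supportProj {n : ℕ} (U : Finset (Fin n)) (i : ℕ) :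
    power 𝕜 (RelFree W n) i ≤ (power 𝕜 (RelFree W n) i).comap (supportProj W n U) :=
  (exists_supportProj W n U).choose_spec.2 i

theorem mono_eq_zero {n c : ℕ} (h : power 𝕜 (RelFree W n) (c + 1) = ⊥) {m : FreeMagma (Fin n)}
    (hm : c < m.length) : mono W n m = 0 := by
  obtain ⟨m', a, hm', e⟩ := exists_lift_eq_of_le_length (gen W n) m (c + 1) (by omega) hm
  have h1 : mono W n m ∈ power 𝕜 (RelFree W n) (c + 1) := Submodule.subset_span ⟨m', a, hm', e⟩
  rwa [h, Submodule.mem_bot] at h1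

theorem finiteDimensional_relFree {n c : ℕ} (h : power 𝕜 (RelFree W n) (c + 1) = ⊥) :
    FiniteDimensional 𝕜 (RelFree W n) := by
  have h1 : Submodule.span 𝕜 (mono W n '' {m | m.length ≤ c}) = ⊤ := by
    rw [eq_top_iff, ← span_range_mono, Submodule.span_le]
    rintro _ ⟨m, rfl⟩
    rcases le_or_gt m.length c with hm | hm
    · exact Submodule.subset_span ⟨m, hm, rfl⟩
    · rw [mono_eq_zero h hm]
      exact Submodule.zero_mem _
  refine .of_fg_top ?_
  rw [← h1]
  exact Submodule.fg_span ((finite_setOf_length_le _ c).image _)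

theorem isSupportDecomposition_supportProj {n c : ℕ} (h : power 𝕜 (RelFree W n) (c + 1) = ⊥) :
    IsSupportDecomposition c (supportProj W n) where
  sum_apply := by
    have h1 : ∑ S, supportProj W n S = LinearMap.id := by
      refine linearMap_ext_mono fun m => ?_
      rw [LinearMap.sum_apply]
      simp [supportProj_mono]
    intro x
    rw [← LinearMap.sum_apply, h1, LinearMap.id_apply]
  apply_self := by
    intro S x
    have h1 : supportProj W n S ∘ₗ supportProj W n S = supportProj W n S := by
      refine linearMap_ext_mono fun m => ?_
      rw [LinearMap.comp_apply, supportProj_mono]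
      split_ifs with h2
      · rw [supportProj_mono, if_pos h2]
      · rw [map_zero]
    exact DFunLike.congr_fun h1 x
  eq_zero := by
    intro S hS
    refine linearMap_ext_mono fun m => ?_
    rw [supportProj_mono, LinearMap.zero_apply]
    split_ifs with h2
    · exact mono_eq_zero h (hS.trans_le (h2 ▸ card_supp_le m))
    · rfl

end RelFree

/-! ### Products with the generators in a central class -/

section Generators

variable {𝕜 : Type u} [Field 𝕜] {W : Set (FreeNonUnitalNonAssocAlgebra 𝕜 ℕ)} {n c : ℕ}

/-- The map induced by `supportProj W n U` on `F_n / F_n ^ c`. -/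
noncomputable def supportProjQuot (c : ℕ) (U : Finset (Fin n)) :
    (RelFree W n ⧸ power 𝕜 (RelFree W n) c) →ₗ[𝕜] (RelFree W n ⧸ power 𝕜 (RelFree W n) c) :=
  (power 𝕜 (RelFree W n) c).mapQ _ (supportProj W n U) (power_le_comap_supportProj U c)

theorem isSupportDecomposition_supportProjQuot
    (h : power 𝕜 (RelFree W n) (c + 1) = ⊥) :
    IsSupportDecomposition c (supportProjQuot (W := W) (n := n) c) where
  sum_apply x := by
    obtain ⟨x, rfl⟩ := Submodule.mkQ_surjective _ x
    simp only [supportProjQuot, Submodule.mkQ_apply, Submodule.mapQ_apply]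
    simp only [← Submodule.mkQ_apply]
    rw [← map_sum, (isSupportDecomposition_supportProj h).sum_apply]
  apply_self S x := by
    obtain ⟨x, rfl⟩ := Submodule.mkQ_surjective _ x
    simp only [supportProjQuot, Submodule.mkQ_apply, Submodule.mapQ_apply]
    rw [(isSupportDecomposition_supportProj h).apply_self]
  eq_zero S hS := by
    refine LinearMap.ext fun x => ?_
    obtain ⟨x, rfl⟩ := Submodule.mkQ_surjective _ x
    simp only [supportProjQuot, Submodule.mkQ_apply, Submodule.mapQ_apply]
    rw [(isSupportDecomposition_supportProj h).eq_zero S hS]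
    simp

theorem power_le_ker_mul (hann : annihilator 𝕜 (RelFree W n) = power 𝕜 (RelFree W n) c) (a : RelFree W n) :
    power 𝕜 (RelFree W n) c ≤ LinearMap.ker (LinearMap.mulRight 𝕜 a) ⊓
      LinearMap.ker (LinearMap.mulLeft 𝕜 a) := by
  intro x hx
  rw [← hann] at hx
  exact ⟨(hx a).2, (hx a).1⟩

variable (hann : annihilator 𝕜 (RelFree W n) = power 𝕜 (RelFree W n) c)

/-- Right multiplication by `x_j`, as a map `F_n / F_n ^ c → F_n`: it is well defined because `F_n ^ c` is
the annihilator. -/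
noncomputable def mulGenRight (j : Fin n) :
    (RelFree W n ⧸ power 𝕜 (RelFree W n) c) →ₗ[𝕜] RelFree W n :=
  (power 𝕜 (RelFree W n) c).liftQ (LinearMap.mulRight 𝕜 (gen W n j))
    ((power_le_ker_mul hann _).trans inf_le_left)

/-- Left multiplication by `x_j`, as a map `F_n / F_n ^ c → F_n`. -/
noncomputable def mulGenLeft (j : Fin n) :
    (RelFree W n ⧸ power 𝕜 (RelFree W n) c) →ₗ[𝕜] RelFree W n :=
  (power 𝕜 (RelFree W n) c).liftQ (LinearMap.mulLeft 𝕜 (gen W n j))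
    ((power_le_ker_mul hann _).trans inf_le_right)

theorem mulGenRight_mkQ (j : Fin n) (x : RelFree W n) :
    mulGenRight hann j ((power 𝕜 (RelFree W n) c).mkQ x) = x * gen W n j := rfl

theorem mulGenLeft_mkQ (j : Fin n) (x : RelFree W n) :
    mulGenLeft hann j ((power 𝕜 (RelFree W n) c).mkQ x) = gen W n j * x := rfl

theorem supportProjQuot_mkQ (U : Finset (Fin n)) (x : RelFree W n) :
    supportProjQuot c U ((power 𝕜 (RelFree W n) c).mkQ x) =
      (power 𝕜 (RelFree W n) c).mkQ (supportProj W n U x) := rfl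

theorem raisesSupport_mulGenRight (j : Fin n) :
    RaisesSupport (supportProjQuot c) (supportProj W n) j (mulGenRight hann j) := by
  intro S U x
  obtain ⟨x, rfl⟩ := Submodule.mkQ_surjective _ x
  rw [supportProjQuot_mkQ, mulGenRight_mkQ]
  have h : supportProj W n U ∘ₗ LinearMap.mulRight 𝕜 (gen W n j) ∘ₗ supportProj W n S =
      if U = insert j S then LinearMap.mulRight 𝕜 (gen W n j) ∘ₗ supportProj W n S else 0 := by
    refine linearMap_ext_mono fun m => ?_
    by_cases hm : supp m = S
    · have h1 : mono W n m * gen W n j = mono W n (m * FreeMagma.of j) := by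
        rw [map_mul, mono_of]
      have h2 : supp (m * FreeMagma.of j) = insert j S := by
        rw [supp_mul, supp_of, hm, Finset.union_comm]; rfl
      rw [LinearMap.comp_apply, LinearMap.comp_apply, supportProj_mono, if_pos hm,
        LinearMap.mulRight_apply, h1, supportProj_mono, h2]
      simp only [eq_comm (a := insert j S)]
      split_ifs
      · rw [LinearMap.comp_apply, supportProj_mono, if_pos hm, LinearMap.mulRight_apply, h1]
      · rfl
    · rw [LinearMap.comp_apply, LinearMap.comp_apply, supportProj_mono, if_neg hm, map_zero,
        map_zero]
      split_ifs
      · rw [LinearMap.comp_apply, supportProj_mono, if_neg hm, map_zero]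
      · rfl
  have h' := DFunLike.congr_fun h x
  rw [LinearMap.comp_apply, LinearMap.comp_apply, LinearMap.mulRight_apply] at h'
  rw [h']
  split_ifs <;> rfl

theorem raisesSupport_mulGenLeft (j : Fin n) :
    RaisesSupport (supportProjQuot c) (supportProj W n) j (mulGenLeft hann j) := by
  intro S U x
  obtain ⟨x, rfl⟩ := Submodule.mkQ_surjective _ x
  rw [supportProjQuot_mkQ, mulGenLeft_mkQ]
  have h : supportProj W n U ∘ₗ LinearMap.mulLeft 𝕜 (gen W n j) ∘ₗ supportProj W n S =
      if U = insert j S then LinearMap.mulLeft 𝕜 (gen W n j) ∘ₗ supportProj W n S else 0 := by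
    refine linearMap_ext_mono fun m => ?_
    by_cases hm : supp m = S
    · have h1 : gen W n j * mono W n m = mono W n (FreeMagma.of j * m) := by
        rw [map_mul, mono_of]
      have h2 : supp (FreeMagma.of j * m) = insert j S := by
        rw [supp_mul, supp_of, hm]; rfl
      rw [LinearMap.comp_apply, LinearMap.comp_apply, supportProj_mono, if_pos hm,
        LinearMap.mulLeft_apply, h1, supportProj_mono, h2]
      simp only [eq_comm (a := insert j S)]
      split_ifs
      · rw [LinearMap.comp_apply, supportProj_mono, if_pos hm, LinearMap.mulLeft_apply, h1]
      · rfl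
    · rw [LinearMap.comp_apply, LinearMap.comp_apply, supportProj_mono, if_neg hm, map_zero,
        map_zero]
      split_ifs
      · rw [LinearMap.comp_apply, supportProj_mono, if_neg hm, map_zero]
      · rfl
  have h' := DFunLike.congr_fun h x
  rw [LinearMap.comp_apply, LinearMap.comp_apply, LinearMap.mulLeft_apply] at h'
  rw [h']
  split_ifs <;> rfl

/-- An element `z` not involving `x_j` that is annihilated by `x_j` on both sides is annihilated by every
`a`: substitute `a` for `x_j`. -/
theorem mem_annihilator_of_mul_gen_eq_zero {T : Finset (Fin n)} {j : Fin n} (hj : j ∉ T)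
    {z : RelFree W n} (hz : z ∈ LinearMap.range (supportProj W n T))
    (hr : z * gen W n j = 0) (hl : gen W n j * z = 0) :
    z ∈ annihilator 𝕜 (RelFree W n) := by
  intro a
  obtain ⟨φ, hφ⟩ := exists_hom (satisfies_relFree W n) (fun i => if i ∈ T then gen W n i else a)
  have hφj : φ (gen W n j) = a := by rw [hφ, if_neg hj]
  have hφz : φ z = z := by
    obtain ⟨y, rfl⟩ := hz
    have h : (φ : RelFree W n →ₗ[𝕜] RelFree W n) ∘ₗ supportProj W n T = supportProj W n T := by
      refine linearMap_ext_mono fun m => ?_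
      rw [LinearMap.comp_apply, supportProj_mono]
      split_ifs with hm
      · refine (map_mono φ hφ m).trans (lift_congr_supp fun i hi => if_pos (hm ▸ hi))
      · exact map_zero _
    exact DFunLike.congr_fun h y
  constructor
  · rw [← hφj, ← hφz, ← map_mul, hl, map_zero]
  · rw [← hφj, ← hφz, ← map_mul, hr, map_zero]

theorem eq_zero_of_mulGen_eq_zero {T : Finset (Fin n)} {j : Fin n} (hj : j ∉ T)
    {x : RelFree W n ⧸ power 𝕜 (RelFree W n) c} (hx : supportProjQuot c T x = x)
    (hr : mulGenRight hann j x = 0) (hl : mulGenLeft hann j x = 0) : x = 0 := by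
  obtain ⟨y, rfl⟩ := Submodule.mkQ_surjective _ x
  rw [supportProjQuot_mkQ] at hx
  rw [← hx] at hr hl ⊢
  rw [mulGenRight_mkQ] at hr
  rw [mulGenLeft_mkQ] at hl
  have h := mem_annihilator_of_mul_gen_eq_zero hj ⟨y, rfl⟩ hr hl
  rw [hann] at h
  exact (Submodule.Quotient.mk_eq_zero _).2 h

/-- The span of the products, on either side, of the elements of a subspace of `F_n / F_n ^ c` with the
generators. -/
noncomputable def genProducts (P : Submodule 𝕜 (RelFree W n ⧸ power 𝕜 (RelFree W n) c)) :
    Submodule 𝕜 (RelFree W n) :=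
  ⨆ j, P.map (mulGenRight hann j) ⊔ P.map (mulGenLeft hann j)

theorem mul_finrank_le_genProducts (h : power 𝕜 (RelFree W n) (c + 1) = ⊥)
    (P : Submodule 𝕜 (RelFree W n ⧸ power 𝕜 (RelFree W n) c)) :
    (n - c) * Module.finrank 𝕜 P ≤ 2 * c * Module.finrank 𝕜 (genProducts hann P) := by
  have := finiteDimensional_relFree h
  exact mul_finrank_le (isSupportDecomposition_supportProjQuot h)
    (isSupportDecomposition_supportProj h) (raisesSupport_mulGenRight hann)
    (raisesSupport_mulGenLeft hann)
    (fun T j hj x hx hr hl => eq_zero_of_mulGen_eq_zero hann hj hx hr hl)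
    (fun j => le_sup_left.trans (le_iSup_of_le j le_rfl))
    (fun j => le_sup_right.trans (le_iSup_of_le j le_rfl))

theorem genProducts_map_le (N : AlgIdeal 𝕜 (RelFree W n)) :
    genProducts hann (N.toSubmodule.map (power 𝕜 (RelFree W n) c).mkQ) ≤ N.toSubmodule := by
  refine iSup_le fun j => sup_le ?_ ?_
  · rintro _ ⟨_, ⟨x, hx, rfl⟩, rfl⟩
    exact N.mul_mem_right' (gen W n j) x hx
  · rintro _ ⟨_, ⟨x, hx, rfl⟩, rfl⟩
    exact N.mul_mem_left' (gen W n j) x hx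

end Generators

/-! ### Counting ideals -/

section Ideals

variable {𝕜 : Type u} [Field 𝕜] {P : Type v} [NonUnitalNonAssocRing P] [Module 𝕜 P]

theorem AlgIdeal.toSubmodule_injective :
    Function.Injective (AlgIdeal.toSubmodule : AlgIdeal 𝕜 P → Submodule 𝕜 P) := by
  intro N N' h
  exact AlgIdeal.ext (congrArg (fun Q : Submodule 𝕜 P => Q.carrier) h)

instance [Finite P] : Finite (AlgIdeal 𝕜 P) :=
  Finite.of_injective _ AlgIdeal.toSubmodule_injective

/-- Every subspace of the annihilator is an ideal. -/
theorem card_submodule_annihilator_le [IsScalarTower 𝕜 P P] [SMulCommClass 𝕜 P P] [Finite P] :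
    Nat.card (Submodule 𝕜 (annihilator 𝕜 P)) ≤
      {N : AlgIdeal 𝕜 P | N.toSubmodule ≤ annihilator 𝕜 P}.ncard := by
  let g : Submodule 𝕜 (annihilator 𝕜 P) → AlgIdeal 𝕜 P := fun Q =>
    { Q.map (annihilator 𝕜 P).subtype with
      mul_mem_left' := by
        rintro a _ ⟨x, -, rfl⟩
        change a * (x : P) ∈ Q.map (annihilator 𝕜 P).subtype
        rw [(x.2 a).1]
        exact Submodule.zero_mem _
      mul_mem_right' := by
        rintro a _ ⟨x, -, rfl⟩
        change (x : P) * a ∈ Q.map (annihilator 𝕜 P).subtype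
        rw [(x.2 a).2]
        exact Submodule.zero_mem _ }
  have hg : Function.Injective g := by
    intro Q Q' h
    exact Submodule.map_injective_of_injective (annihilator 𝕜 P).injective_subtype
      (congrArg AlgIdeal.toSubmodule h)
  rw [← Set.ncard_univ]
  refine Set.ncard_le_ncard_of_injOn g (fun Q _ => ?_) hg.injOn (Set.toFinite _)
  rintro _ ⟨x, -, rfl⟩
  exact x.2

end Ideals

section Generic

variable {𝕜 : Type u} [Field 𝕜] [Finite 𝕜] {W : Set (FreeNonUnitalNonAssocAlgebra 𝕜 ℕ)} {c : ℕ}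

/-- Once `n` is at least `2 c l` plus a constant, the ideals outside `F_n ^ c` are at least `2 ^ l` times
rarer than those inside. -/
theorem ncard_ideals_not_le_power_mul_le {n : ℕ} (hc : 0 < c)
    (hann : annihilator 𝕜 (RelFree W n) = power 𝕜 (RelFree W n) c)
    (h : power 𝕜 (RelFree W n) (c + 1) = ⊥) {l : ℕ} (hn : c + 2 * c * (l + 5) ≤ n) :
    {N : AlgIdeal 𝕜 (RelFree W n) | ¬ N.toSubmodule ≤ power 𝕜 (RelFree W n) c}.ncard * 2 ^ l ≤
      {N : AlgIdeal 𝕜 (RelFree W n) | N.toSubmodule ≤ power 𝕜 (RelFree W n) c}.ncard := by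
  have := finiteDimensional_relFree h
  have : Finite (RelFree W n) := Module.finite_of_finite 𝕜
  set Z := power 𝕜 (RelFree W n) c with hZ
  set d := Module.finrank 𝕜 Z with hd
  set e := Module.finrank 𝕜 (RelFree W n ⧸ Z) with he
  have hgrow : ∀ P : Submodule 𝕜 (RelFree W n ⧸ Z),
      (l + 5) * Module.finrank 𝕜 P ≤ Module.finrank 𝕜 (genProducts hann P) := by
    intro P
    refine Nat.le_of_mul_le_mul_left ?_ (show 0 < 2 * c by omega)
    calc 2 * c * ((l + 5) * Module.finrank 𝕜 P) = 2 * c * (l + 5) * Module.finrank 𝕜 P := by ring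
      _ ≤ (n - c) * Module.finrank 𝕜 P := Nat.mul_le_mul_right _ (by omega)
      _ ≤ _ := mul_finrank_le_genProducts hann h P
  -- Apply the growth inequality to `F_n / F_n ^ c` itself; all products lie in `F_n`, of dimension `d + e`.
  have hde : (l + 5) * e ≤ d + e := by
    have h1 := hgrow ⊤
    have h2 := (genProducts hann (⊤ : Submodule 𝕜 (RelFree W n ⧸ Z))).finrank_le
    have h3 := Z.finrank_quotient_add_finrank
    rw [finrank_top, ← he] at h1
    rw [← he, ← hd] at h3
    omega
  have hde' : l * e + 4 * e ≤ d := by nlinarith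
  have hbad : {N : AlgIdeal 𝕜 (RelFree W n) | ¬ N.toSubmodule ≤ Z}.ncard ≤
      {N : Submodule 𝕜 (RelFree W n) | ¬ N ≤ Z ∧ genProducts hann (N.map Z.mkQ) ≤ N}.ncard :=
    Set.ncard_le_ncard_of_injOn AlgIdeal.toSubmodule
      (fun N hN => ⟨hN, genProducts_map_le hann N⟩) AlgIdeal.toSubmodule_injective.injOn
      (Set.toFinite _)
  rcases Nat.eq_zero_or_pos e with he0 | he0
  · have : Subsingleton (RelFree W n ⧸ Z) := Module.finrank_zero_iff.1 he0
    have hemp : {N : AlgIdeal 𝕜 (RelFree W n) | ¬ N.toSubmodule ≤ Z} = ∅ := by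
      refine Set.eq_empty_iff_forall_notMem.2 fun N hN => hN fun x _ => ?_
      exact (Submodule.Quotient.mk_eq_zero Z).1 (Subsingleton.elim _ _)
    rw [hemp, Set.ncard_empty, zero_mul]
    exact Nat.zero_le _
  · have hgood : Nat.card (Submodule 𝕜 Z) ≤
        {N : AlgIdeal 𝕜 (RelFree W n) | N.toSubmodule ≤ Z}.ncard := by
      have h1 := card_submodule_annihilator_le (𝕜 := 𝕜) (P := RelFree W n)
      rwa [hann] at h1
    have hmain := ncard_not_le_mul_pow_le Z (genProducts hann)
      (fun P => (Nat.mul_le_mul_right _ (by omega)).trans (hgrow P)) (by omega)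
    have hl : l ≤ d - 4 * e := by nlinarith [Nat.sub_add_cancel (show 4 * e ≤ d by omega)]
    calc _ ≤ _ * Nat.card 𝕜 ^ (d - 4 * e) :=
          Nat.mul_le_mul hbad ((Nat.pow_le_pow_right two_pos hl).trans
            (Nat.pow_le_pow_left Finite.one_lt_card _))
      _ ≤ _ := hmain.trans hgood

/-- If the complement of `T n` has at most `2 ^ (-l)` times as many elements as `T n` for all
`l ≤ (n - b) / a`, then `T` is exponentially generic, with `r = 2 ^ (-1 / (2 a))`. -/
theorem isExponentiallyGeneric_of_ncard_compl_le {S : ℕ → Type v} (T : ∀ n, Set (S n))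
    (hS : ∀ n, Finite (S n)) (hne : ∀ n, Nonempty (S n)) {a b : ℕ} (ha : 0 < a)
    (h : ∀ l n : ℕ, b + a * l ≤ n → (T n)ᶜ.ncard * 2 ^ l ≤ (T n).ncard) :
    IsExponentiallyGeneric T := by
  have hle : ∀ n, proportion T n ≤ 1 := by
    intro n
    refine div_le_one_of_le₀ ?_ (Nat.cast_nonneg _)
    rw [← Set.ncard_univ]
    exact_mod_cast Set.ncard_le_ncard (Set.subset_univ _) (Set.toFinite _)
  have hlow : ∀ l n : ℕ, b + a * l ≤ n → 1 - (1 / 2 : ℝ) ^ l ≤ proportion T n := by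
    intro l n hn
    have h1 : ((T n)ᶜ.ncard : ℝ) * 2 ^ l ≤ (T n).ncard := by exact_mod_cast h l n hn
    have h2 : ((T n).ncard : ℝ) + (T n)ᶜ.ncard = Nat.card (S n) := by
      exact_mod_cast Set.ncard_add_ncard_compl (T n)
    have h3 : (0 : ℝ) < Nat.card (S n) := by exact_mod_cast Nat.card_pos
    have h4 : ((T n)ᶜ.ncard : ℝ) ≤ (1 / 2) ^ l * Nat.card (S n) := by
      have h5 : ((T n)ᶜ.ncard : ℝ) = (1 / 2) ^ l * ((T n)ᶜ.ncard * 2 ^ l) := by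
        rw [mul_comm, mul_assoc, ← mul_pow]; norm_num
      rw [h5]
      refine mul_le_mul_of_nonneg_left ?_ (by positivity)
      have : (0 : ℝ) ≤ (T n)ᶜ.ncard := Nat.cast_nonneg _
      linarith
    rw [proportion, le_div_iff₀ h3]
    linarith
  obtain ⟨r, hr0, hr1, hr⟩ : ∃ r : ℝ, 0 < r ∧ r < 1 ∧ r ^ (2 * a) = 1 / 2 := by
    refine ⟨(1 / 2 : ℝ) ^ (1 / ((2 * a : ℕ) : ℝ)), by positivity, ?_, ?_⟩
    · exact Real.rpow_lt_one (by norm_num) (by norm_num) (by positivity)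
    · rw [← Real.rpow_natCast, ← Real.rpow_mul (by norm_num), one_div_mul_cancel
        (by positivity), Real.rpow_one]
  have hev : ∀ᶠ n in atTop, 1 - r ^ n < proportion T n := by
    filter_upwards [eventually_ge_atTop (2 * (b + a) + 1)] with n hn
    set l := (n - b) / a with hl
    have h1 : a * l ≤ n - b := Nat.mul_div_le _ _
    have h2 : n - b < a * (l + 1) := Nat.lt_mul_div_succ _ ha
    have h3 : n < 2 * a * l := by
      have h4 : a * (l + 1) = a * l + a := by ring
      have h5 : 2 * a * l = 2 * (a * l) := by ring
      omega
    have h4 : (1 / 2 : ℝ) ^ l < r ^ n := by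
      rw [← hr, ← pow_mul]
      exact pow_lt_pow_right_of_lt_one₀ hr0 hr1 h3
    linarith [hlow l n (by omega)]
  refine ⟨hS, ?_, r, hr0.le, hr1, hev⟩
  refine tendsto_of_tendsto_of_tendsto_of_le_of_le' ?_ tendsto_const_nhds
    (hev.mono fun n hn => hn.le) (.of_forall hle)
  simpa using (tendsto_pow_atTop_nhds_zero_of_lt_one hr0.le hr1).const_sub 1

end Generic

end NilAlg

theorem mainTheorem8 {𝕜 : Type*} [Field 𝕜] [Finite 𝕜] (c : ℕ)
    (W : Set (FreeNonUnitalNonAssocAlgebra 𝕜 ℕ)) (hW : NilAlg.IsCentralClass W c) :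
    NilAlg.IsExponentiallyGeneric
      (S := fun n : ℕ => NilAlg.AlgIdeal 𝕜 (NilAlg.RelFree W n))
      (fun n : ℕ => {N : NilAlg.AlgIdeal 𝕜 (NilAlg.RelFree W n) |
        N.toSubmodule ≤ NilAlg.power 𝕜 (NilAlg.RelFree W n) c}) := by
  obtain ⟨hc, ⟨hnil, -⟩, hann⟩ := hW
  have hpow : ∀ n, NilAlg.power 𝕜 (NilAlg.RelFree W n) (c + 1) = ⊥ := fun n =>
    hnil _ (NilAlg.satisfies_relFree W n)
  refine NilAlg.isExponentiallyGeneric_of_ncard_compl_le _ (fun n => ?_)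
    (fun n => ⟨NilAlg.idealSpan 𝕜 _ ∅⟩) (a := 2 * c) (b := c + 10 * c) (by omega)
    fun l n hn => ?_
  · have := NilAlg.finiteDimensional_relFree (hpow n)
    have : Finite (NilAlg.RelFree W n) := Module.finite_of_finite 𝕜
    infer_instance
  · refine NilAlg.ncard_ideals_not_le_power_mul_le (by omega) (hann n (by nlinarith)) (hpow n) ?_
    calc c + 2 * c * (l + 5) = c + 10 * c + 2 * c * l := by ring
      _ ≤ n := hn
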